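/- Let $\mathcal A$ be an abelian category, and let $\mathcal X$ be a full subcategory of $\mathcal A$, closed under isomorphisms and finite direct sums (in particular containing $0$). Assume that $\mathcal X$ is contravariantly finite, i.e. for every $M\in\mathcal A$ there is a morphism $f:X\to M$ with $X\in\mathcal X$ such that $\operatorname{Hom}_{\mathcal A}(X',f)$ is surjective for all $X'\in\mathcal X$, and that $\mathcal X$ generates $\mathcal A$, i.e. for every $M\in\mathcal A$ there is an epimorphism $X\to M$ with $X\in\mathcal X$. Then $$\mathcal X\text{-}\dim D^{\mathrm b}(\mathcal A)\ \le\ \operatorname{gl.dim}(\operatorname{mod}\mathcal X)\qquad\text{in } \mathbb N\cup\{\infty\}.$$ Here: - $\operatorname{mod}\mathcal X$ is the abelian category of finitely presented $\mathcal X$-modules, i.e. of the additive functors $F:\mathcal X^{\mathrm{op}}\to\mathrm{Ab}$ admitting an exact sequence $\operatorname{Hom}_{\mathcal X}(-,X_1)\to\operatorname{Hom}_{\mathcal X}(-,X_0)\to F\to0$ with $X_0,X_1\in\mathcal X$. - The global dimension is the supremum of the projective dimensions of all objects; the projective dimension of $M$ is the infimum of the integers $d\ge0$ for which there is an exact sequence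 $0\to P_d\to\cdots\to P_0\to M\to0$ with all $P_i$ projective (so the zero object has projective dimension $0$). - For a triangulated category $\mathcal T$ and a full subcategory $\mathcal Y$ of $\mathcal T$, $\mathcal Y\text{-}\dim\mathcal T=\inf\{n\ge0\mid\mathcal T=\langle\mathcal Y\rangle_{n+1}\}$, where $\langle\mathcal Y\rangle=\operatorname{add}\{Y[i]\mid Y\in\mathcal Y,\ i\in\mathbb Z\}$ is the closure of all shifts of objects of $\mathcal Y$ under finite direct sums and direct summands, $\langle\mathcal Y\rangle_{m}=\operatorname{add}(\langle\mathcal Y\rangle*\cdots*\langle\mathcal Y\rangle)$ with $m$ factors, and $\mathcal U*\mathcal V$ consists of the objects $M$ admitting an exact triangle $U\to M\to V\to U[1]$ with $U\in\mathcal U$ and $V\in\mathcal V$. - In $\mathcal X\text{-}\dim D^{\mathrm b}(\mathcal A)$, $\mathcal X$ is regarded as a subcategory of the bounded derived category $D^{\mathrm b}(\mathcal A)$ via complexes concentrated in degree $0$. -/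

import Mathlib

open CategoryTheory CategoryTheory.Limits

universe w v u

noncomputable section

namespace RelDim

section FunctorCategory

variable {C : Type u} [Category.{v} C] [Preadditive C]

/-- `F` is a finitely presented `C`-module: an additive contravariant functor from `C` to abelian
groups for which there is an exact sequence `Hom(-, X₁) ⟶ Hom(-, X₀) ⟶ F ⟶ 0`. -/
def IsFinitelyPresented : ObjectProperty (Cᵒᵖ ⥤ AddCommGrpCat.{v}) := fun F =>
  F.Additive ∧
    ∃ (X₁ X₀ : C) (a : X₁ ⟶ X₀) (p : preadditiveYoneda.obj X₀ ⟶ F)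
      (h : preadditiveYoneda.map a ≫ p = 0),
      (ShortComplex.mk (preadditiveYoneda.map a) p h).Exact ∧ Epi p

variable (C) in
/-- The category `mod C` of finitely presented `C`-modules, a full subcategory of the category of
functors from `Cᵒᵖ` to abelian groups. -/
abbrev FPMod : Type max u (v + 1) :=
  (IsFinitelyPresented (C := C)).FullSubcategory

/-- Representable functors are finitely presented (if there is a zero object). -/
theorem isFinitelyPresented_representable [HasZeroObject C] (X : C) :
    IsFinitelyPresented (preadditiveYoneda.obj X) := by
  refine ⟨inferInstance, _, X, (0 : (HasZeroObject.zero' C).zero ⟶ X), 𝟙 _, by simp, ?_,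
    inferInstance⟩
  rw [ShortComplex.exact_iff_mono _ (by simp)]
  infer_instance

instance [HasZeroObject C] : (IsFinitelyPresented (C := C)).ContainsZero := by
  obtain ⟨Z, hZ⟩ := HasZeroObject.zero (C := C)
  exact ⟨_, preadditiveYoneda.map_isZero hZ, isFinitelyPresented_representable Z⟩

end FunctorCategory

section GlobalDimension

variable (C : Type u) [Category.{v} C] [HasZeroObject C] [HasZeroMorphisms C]

variable {C} in
/-- The projective dimension of `M`: the infimum in `ℕ ∪ {∞}` of the `d` for which there is an
exact sequence `0 ⟶ P_d ⟶ ⋯ ⟶ P_0 ⟶ M ⟶ 0` with all `P_i` projective, that is, a projective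
resolution vanishing in degrees above `d`. -/
def projDim (M : C) : ℕ∞ :=
  ⨅ (d : ℕ) (_ : ∃ P : ProjectiveResolution M, ∀ i, d < i → IsZero (P.complex.X i)), (d : ℕ∞)

/-- The global dimension: the supremum of the projective dimensions of all objects. -/
def gldim : ℕ∞ := ⨆ M : C, projDim M

end GlobalDimension

section Subcategories

variable {A : Type u} [Category.{v} A]

/-- A full subcategory `X` is contravariantly finite if each object `M` has a right
`X`-approximation: a morphism `f : X₀ ⟶ M` with `X₀` in `X` through which each morphism
from an object of `X` to `M` factors. -/
def IsContravariantlyFinite (X : ObjectProperty A) : Prop :=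
  ∀ M : A, ∃ (X₀ : A) (_ : X X₀) (f : X₀ ⟶ M),
    ∀ (X' : A) (_ : X X') (g : X' ⟶ M), ∃ h : X' ⟶ X₀, h ≫ f = g

/-- `X` generates the category if each object is a quotient of an object of `X`. -/
def Generates (X : ObjectProperty A) : Prop :=
  ∀ M : A, ∃ (X₀ : A) (_ : X X₀) (f : X₀ ⟶ M), Epi f

end Subcategories

section TriangulatedDimension

variable {T : Type u} [Category.{v} T] [HasZeroObject T] [HasShift T ℤ] [Preadditive T]
  [∀ n : ℤ, (shiftFunctor T n).Additive] [Pretriangulated T]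

/-- The dimension of a triangulated category `T` with respect to a (nonempty) full subcategory `X`:
the infimum in `ℕ ∪ {∞}` of the `n ≥ 0` with `T = ⟨X⟩_{n+1}`. Here `⟨X⟩` is the closure of
all shifts of objects of `X` under finite direct sums and direct summands, and `⟨X⟩_{n+1}` is
the closure under direct summands of `⟨X⟩ * ⋯ * ⟨X⟩` (`n + 1` factors, so `n` extensions);
Mathlib's name for `⟨X⟩_{n+1}` is `X.triangEnvelopeIter n`. -/
def triangDim (X : ObjectProperty T) : ℕ∞ :=
  ⨅ (n : ℕ) (_ : X.triangEnvelopeIter n = ⊤), (n : ℕ∞)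

end TriangulatedDimension

section Derived

variable {A : Type u} [Category.{v} A] [Abelian A] [HasDerivedCategory.{w} A]

/-- A full subcategory `X` of `A`, regarded as a full subcategory (closed under isomorphisms) of the
bounded derived category of `A`: the complexes isomorphic to an object of `X` placed in
degree `0`. -/
def inDegreeZero (X : ObjectProperty A) : ObjectProperty (DerivedCategory.Bounded A) := fun K =>
  ∃ (X₀ : A) (_ : X X₀), Nonempty (K.obj ≅ (DerivedCategory.singleFunctor A 0).obj X₀)

end Derived

end RelDim

end

noncomputable section

namespace RelDim

/-! ### Exactness in functor categories, tested on elements. -/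

section PointwiseExactness

variable {J : Type u} [Category.{v} J]

/-! For a complex `M` in the homotopy category, let `hoHom X j` send `M` to the `j`-th cohomology of
`Hom(-, M)` restricted to `X`. Contravariant finiteness makes it finitely presented
(`isFinitelyPresented_hoHom`), so if the global dimension is `n` it has a projective resolution with
`n + 1` terms. Each term is `Hom(-, N)` with `N` a retract of an object of `X`, since idempotents
split in `A`.

By Yoneda the projective covers in the various degrees come from one map `⨁ N_j[-j] ⟶ M`. It is
surjective on every `hoHom X j`, so its cocone `W` realizes the first syzygies in all degrees at
once (`exists_syzygy_triangle`). After `n + 1` such steps all these functors vanish. As `X`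
generates, the remaining complex is then acyclic and dies in the derived category (`isZero_Qh_obj`).
A bounded object is represented by a strictly bounded complex, so only finitely many degrees occur,
and it is built from `n + 1` layers in `⟨X⟩` (`triangEnvelopeIter_of_hasRes`). -/

theorem exact_iff_pointwise (S : ShortComplex (J ⥤ AddCommGrpCat.{w})) :
    S.Exact ↔ ∀ j, ∀ x : S.X₂.obj j, S.g.app j x = 0 → ∃ y : S.X₁.obj j, S.f.app j y = x := by
  have key : S.Exact ↔ ∀ j, (S.map ((evaluation J AddCommGrpCat.{w}).obj j)).Exact := by
    constructor
    · intro h j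
      exact h.map _
    · intro h
      rw [ShortComplex.exact_iff_isZero_homology, Functor.isZero_iff]
      intro j
      exact ((ShortComplex.exact_iff_isZero_homology _).1 (h j)).of_iso
        (S.mapHomologyIso ((evaluation J AddCommGrpCat.{w}).obj j)).symm
  rw [key]
  refine forall_congr' fun j => ?_
  rw [ShortComplex.ab_exact_iff]
  rfl

theorem epi_iff_pointwise {F G : J ⥤ AddCommGrpCat.{w}} (p : F ⟶ G) :
    Epi p ↔ ∀ j, Function.Surjective (p.app j) := by
  rw [NatTrans.epi_iff_epi_app]
  exact forall_congr' fun j => AddCommGrpCat.epi_iff_surjective _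

theorem mono_iff_pointwise {F G : J ⥤ AddCommGrpCat.{w}} (p : F ⟶ G) :
    Mono p ↔ ∀ j, Function.Injective (p.app j) := by
  rw [NatTrans.mono_iff_mono_app]
  exact forall_congr' fun j => AddCommGrpCat.mono_iff_injective _

end PointwiseExactness

/-! ### Yoneda for additive functors, and cokernels of finitely presented modules. -/

section Yoneda

variable {C : Type u} [Category.{v} C] [Preadditive C]

/-- The morphism from a representable functor to an additive functor given by an element. -/
def yonedaDesc {X : C} (F : Cᵒᵖ ⥤ AddCommGrpCat.{v}) [F.Additive] (x : F.obj (.op X)) :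
    preadditiveYoneda.obj X ⟶ F where
  app Y := AddCommGrpCat.ofHom (AddMonoidHom.mk' (fun (f : Y.unop ⟶ X) => F.map f.op x)
    (fun (f g : Y.unop ⟶ X) => by
      change F.map (f + g).op x = _
      rw [op_add, F.map_add]
      rfl))
  naturality Y Z f := by
    ext (g : Y.unop ⟶ X)
    change F.map (f.unop ≫ g).op x = F.map f (F.map g.op x)
    simp

theorem preadditiveYoneda_hom_app {X Y : C} {F : Cᵒᵖ ⥤ AddCommGrpCat.{v}}
    (p : preadditiveYoneda.obj X ⟶ F) (f : Y ⟶ X) :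
    p.app (.op Y) f = F.map f.op (p.app (.op X) (𝟙 X)) := by
  have := ConcreteCategory.congr_hom (p.naturality f.op) (𝟙 X)
  change p.app (.op Y) (f ≫ 𝟙 X) = _ at this
  rw [Category.comp_id] at this
  exact this

theorem preadditiveYoneda_hom_ext {X : C} {F : Cᵒᵖ ⥤ AddCommGrpCat.{v}}
    {p q : preadditiveYoneda.obj X ⟶ F} (h : p.app (.op X) (𝟙 X) = q.app (.op X) (𝟙 X)) :
    p = q := by
  ext Y f
  exact (preadditiveYoneda_hom_app p (Y := Y.unop) f).trans
    ((congrArg _ h).trans (preadditiveYoneda_hom_app q (Y := Y.unop) f).symm)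

theorem additive_of_epi {F G : Cᵒᵖ ⥤ AddCommGrpCat.{v}} [F.Additive] (p : F ⟶ G) [Epi p] :
    G.Additive where
  map_add {X _ f g} := by
    ext y
    obtain ⟨x, rfl⟩ := (epi_iff_pointwise p).1 inferInstance X y
    change G.map (f + g) (p.app X x) = G.map f (p.app X x) + G.map g (p.app X x)
    simp only [← NatTrans.naturality_apply, F.map_add, ← map_add]
    rfl

instance : (preadditiveYoneda : C ⥤ Cᵒᵖ ⥤ AddCommGrpCat.{v}).Additive where
  map_add {X _ f g} := preadditiveYoneda_hom_ext (Preadditive.comp_add _ _ _ (𝟙 X) f g)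

/-- Lift `f` to a map `b` between the representable covers; adjoining `b` to the relations `a` of
`G` presents the cokernel. -/
theorem isFinitelyPresented_cokernel [HasBinaryBiproducts C] {F G : Cᵒᵖ ⥤ AddCommGrpCat.{v}}
    (hF : IsFinitelyPresented F) (hG : IsFinitelyPresented G) (f : F ⟶ G) :
    IsFinitelyPresented (cokernel f) := by
  obtain ⟨_, _, X, _, p, _, _, hp⟩ := hF
  obtain ⟨hG, Y₁, Y₀, a, q, wq, hq, hq'⟩ := hG
  rw [exact_iff_pointwise] at hq
  rw [epi_iff_pointwise] at hp
  have hq'' := (epi_iff_pointwise _).1 hq'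
  obtain ⟨b, hb⟩ := hq'' _ (f.app _ (p.app _ (𝟙 X)))
  change X ⟶ Y₀ at b
  have hb' : preadditiveYoneda.map b ≫ q = p ≫ f := by
    apply preadditiveYoneda_hom_ext
    change q.app _ (𝟙 X ≫ b) = _
    rw [Category.id_comp]
    exact hb
  have w : preadditiveYoneda.map (biprod.desc b a) ≫ q ≫ cokernel.π f = 0 := by
    rw [biprod.desc_eq, Functor.map_add, Functor.map_comp, Functor.map_comp,
      Preadditive.add_comp, Category.assoc, Category.assoc, reassoc_of% hb', reassoc_of% wq,
      cokernel.condition]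
    simp
  refine ⟨additive_of_epi (cokernel.π f), X ⊞ Y₁, Y₀, biprod.desc b a, q ≫ cokernel.π f, w, ?_,
    epi_comp _ _⟩
  rw [exact_iff_pointwise]
  rintro ⟨Z⟩ (c : Z ⟶ Y₀) hc
  obtain ⟨u, hu⟩ := (exact_iff_pointwise _).1 (ShortComplex.exact_cokernel f) (.op Z)
    (q.app (.op Z) c) hc
  obtain ⟨v, rfl⟩ := hp _ u
  change Z ⟶ X at v
  have h₀ : q.app (.op Z) (v ≫ b) = q.app (.op Z) c :=
    (ConcreteCategory.congr_hom (NatTrans.congr_app hb' (.op Z)) v).trans hu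
  obtain ⟨t, ht⟩ := hq (.op Z) (c - v ≫ b : Z ⟶ Y₀) (by
    refine (map_sub (q.app (.op Z)).hom c (v ≫ b)).trans ?_
    exact sub_eq_zero.2 h₀.symm)
  change Z ⟶ Y₁ at t
  change t ≫ a = c - v ≫ b at ht
  refine ⟨biprod.lift v t, ?_⟩
  change biprod.lift v t ≫ biprod.desc b a = c
  rw [biprod.lift_desc, ht]
  abel

end Yoneda

/-! ### Exactness of the inclusion of finitely presented modules. -/

section FPMod

variable {C : Type u} [Category.{v} C] [Preadditive C]

variable (C) in
/-- The inclusion of finitely presented modules in all contravariant functors. -/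
abbrev FPMod.ι : FPMod C ⥤ Cᵒᵖ ⥤ AddCommGrpCat.{v} := (IsFinitelyPresented (C := C)).ι

variable [HasZeroObject C]

/-- The representable functor as a finitely presented module. -/
def FPMod.rep (X : C) : FPMod C := ⟨preadditiveYoneda.obj X, isFinitelyPresented_representable X⟩

/-- Representables are finitely presented and detect elements, so any kernel taken among finitely
presented modules is already a pointwise kernel. -/
instance {F G : FPMod C} (f : F ⟶ G) : PreservesLimit (parallelPair f 0) (FPMod.ι C) := by
  constructor
  intro c hc
  let k := Fork.ι c
  have hk : k ≫ f = 0 := KernelFork.condition c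
  have : Mono k := mono_of_isLimit_fork hc
  have hF : F.obj.Additive := F.property.1
  have hK : c.pt.obj.Additive := c.pt.property.1
  let S : ShortComplex (Cᵒᵖ ⥤ AddCommGrpCat.{v}) :=
    .mk k.hom f.hom (congrArg InducedCategory.Hom.hom hk)
  have hS : S.Exact := by
    rw [exact_iff_pointwise]
    rintro ⟨Z⟩ x hx
    let t : FPMod.rep Z ⟶ F := ObjectProperty.homMk (yonedaDesc F.obj x)
    have ht : t ≫ f = 0 := by
      apply ObjectProperty.hom_ext
      apply preadditiveYoneda_hom_ext
      change f.hom.app _ (F.obj.map (𝟙 Z).op x) = 0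
      simpa using hx
    obtain ⟨l, hl⟩ := KernelFork.IsLimit.lift' hc t ht
    refine ⟨l.hom.app (.op Z) (𝟙 Z), ?_⟩
    change (l ≫ k).hom.app (.op Z) (𝟙 Z) = x
    rw [show l ≫ k = t from hl]
    change F.obj.map (𝟙 Z).op x = x
    simp
  have hS' : Mono S.f := by
    rw [mono_iff_pointwise]
    rintro ⟨Z⟩ x y (hxy : k.hom.app (.op Z) x = k.hom.app (.op Z) y)
    let t (x : c.pt.obj.obj (.op Z)) : FPMod.rep Z ⟶ c.pt := ObjectProperty.homMk (yonedaDesc _ x)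
    have ht : t x = t y := by
      rw [← cancel_mono k]
      apply ObjectProperty.hom_ext
      apply preadditiveYoneda_hom_ext
      change k.hom.app _ (c.pt.obj.map (𝟙 Z).op x) = k.hom.app _ (c.pt.obj.map (𝟙 Z).op y)
      simpa using hxy
    have : c.pt.obj.map (𝟙 Z).op x = c.pt.obj.map (𝟙 Z).op y :=
      congrArg (fun s : FPMod.rep Z ⟶ c.pt => s.hom.app (.op Z) (𝟙 Z)) ht
    simpa using this
  exact ⟨(KernelFork.isLimitMapConeEquiv c (FPMod.ι C)).symm hS.fIsKernel⟩

instance [HasBinaryBiproducts C] {F G : FPMod C} (f : F ⟶ G) :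
    PreservesColimit (parallelPair f 0) (FPMod.ι C) := by
  let Q : FPMod C := ⟨cokernel f.hom, isFinitelyPresented_cokernel F.property G.property f.hom⟩
  let q : G ⟶ Q := ObjectProperty.homMk (cokernel.π f.hom)
  have w : f ≫ q = 0 := ObjectProperty.hom_ext _ (cokernel.condition f.hom)
  have hQ : IsColimit (CokernelCofork.ofπ q w) :=
    CokernelCofork.IsColimit.ofπ _ _
      (fun g hg => ObjectProperty.homMk (cokernel.desc f.hom g.hom
        (congrArg InducedCategory.Hom.hom hg)))
      (fun g hg => ObjectProperty.hom_ext _ (cokernel.π_desc _ _ _))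
      (fun g hg m hm => ObjectProperty.hom_ext _ (by
        rw [← cancel_epi (cokernel.π f.hom)]
        exact (congrArg InducedCategory.Hom.hom hm).trans (cokernel.π_desc _ _ _).symm))
  exact preservesColimit_of_preserves_colimit_cocone hQ
    ((CokernelCofork.isColimitMapCoconeEquiv _ (FPMod.ι C)).symm (cokernelIsCokernel f.hom))

instance [HasBinaryBiproducts C] : (FPMod.ι C).PreservesHomology where

end FPMod

/-! ### Resolutions by functors represented by retracts of objects of `X`. -/

section RelativeResolutions

variable {A : Type u} [Category.{v} A] [Abelian A] (X : ObjectProperty A)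

/-- The functor sending an object `N` of the ambient category to `Hom(-, N)` restricted to the
full subcategory `X`. -/
def relYoneda : A ⥤ X.FullSubcategoryᵒᵖ ⥤ AddCommGrpCat.{v} :=
  preadditiveYoneda ⋙ (Functor.whiskeringLeft _ _ _).obj X.ι.op

/-- On objects of `X`, the restricted Yoneda functor is the Yoneda functor of `X`. -/
def relYonedaIso (X₀ : X.FullSubcategory) :
    (relYoneda X).obj X₀.obj ≅ preadditiveYoneda.obj X₀ :=
  NatIso.ofComponents (fun Y => AddEquiv.toAddCommGrpIso
    { toFun := fun (f : Y.unop.obj ⟶ X₀.obj) => (ObjectProperty.homMk f : Y.unop ⟶ X₀)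
      invFun := fun (f : Y.unop ⟶ X₀) => f.hom
      left_inv := fun _ => rfl
      right_inv := fun _ => rfl
      map_add' := fun _ _ => rfl }) (fun _ => rfl)

theorem relYonedaIso_naturality {X₀ Y₀ : X.FullSubcategory} (f : X₀ ⟶ Y₀) :
    (relYoneda X).map f.hom ≫ (relYonedaIso X Y₀).hom =
      (relYonedaIso X X₀).hom ≫ preadditiveYoneda.map f := rfl

/-- A contravariant functor on `X` has relative length at most `n` if it has a resolution
with at most `n` terms, each of which is represented by a retract of an object of `X`. -/
def HasRes : ℕ → (X.FullSubcategoryᵒᵖ ⥤ AddCommGrpCat.{v}) → Prop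
  | 0, F => IsZero F
  | n + 1, F => ∃ (N : A) (_ : X.retractClosure N) (p : (relYoneda X).obj N ⟶ F),
      Epi p ∧ HasRes n (kernel p)

variable {X}

theorem HasRes.of_iso {n : ℕ} {F G : X.FullSubcategoryᵒᵖ ⥤ AddCommGrpCat.{v}} (e : F ≅ G)
    (h : HasRes X n F) : HasRes X n G := by
  induction n generalizing F G with
  | zero => exact IsZero.of_iso h e.symm
  | succ n ih =>
    obtain ⟨N, hN, p, hp, h⟩ := h
    exact ⟨N, hN, p ≫ e.hom, epi_comp _ _, ih (kernelCompMono p e.hom).symm h⟩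

theorem HasRes.of_shortExact {n : ℕ}
    {S : ShortComplex (X.FullSubcategoryᵒᵖ ⥤ AddCommGrpCat.{v})} (hS : S.ShortExact)
    {N : A} (hN : X.retractClosure N) (e : (relYoneda X).obj N ≅ S.X₂)
    (h : HasRes X n S.X₁) : HasRes X (n + 1) S.X₃ := by
  have := hS.epi_g
  have := hS.mono_f
  refine ⟨N, hN, e.hom ≫ S.g, epi_comp _ _, h.of_iso ?_⟩
  exact (hS.exact.fIsKernel.conePointUniqueUpToIso (kernelIsKernel S.g)) ≪≫
    (kernelIsIsoComp e.hom S.g).symm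

/-- Exactness in degree `k + 1` identifies the opcycles there with the image of the differential in
`K.X k`. Thus the opcycles are the successive syzygies. -/
theorem opcycles_shortExact {B : Type*} [Category* B] [Abelian B] (K : ChainComplex B ℕ) (k : ℕ)
    (hK : K.ExactAt (k + 1)) :
    (ShortComplex.mk (K.fromOpcycles (k + 1) k) (K.pOpcycles k)
      (by simp [← cancel_epi (K.pOpcycles (k + 1))])).ShortExact := by
  have hm : Mono (K.fromOpcycles (k + 1) k) :=
    Preadditive.mono_of_isZero_kernel' _ (K.homologyIsKernel (k + 1) k (by simp))
      hK.isZero_homology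
  refine ⟨?_⟩
  have h := ShortComplex.exact_of_g_is_cokernel (.mk (K.d (k + 1) k) (K.pOpcycles k) (by simp))
    (K.opcyclesIsCokernel (k + 1) k (by simp))
  let φ : ShortComplex.mk (K.d (k + 1) k) (K.pOpcycles k) (by simp) ⟶
    ShortComplex.mk (K.fromOpcycles (k + 1) k) (K.pOpcycles k)
      (by simp [← cancel_epi (K.pOpcycles (k + 1))]) :=
    { τ₁ := K.pOpcycles (k + 1), τ₂ := 𝟙 _, τ₃ := 𝟙 _ }
  have : Epi φ.τ₁ := by dsimp [φ]; infer_instance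
  have : IsIso φ.τ₂ := by dsimp [φ]; infer_instance
  have : Mono φ.τ₃ := by dsimp [φ]; infer_instance
  exact (ShortComplex.exact_iff_of_epi_of_isIso_of_mono φ).1 h

theorem HasRes.opcycles (K : ChainComplex (X.FullSubcategoryᵒᵖ ⥤ AddCommGrpCat.{v}) ℕ)
    (hK : ∀ k, ∃ (N : A) (_ : X.retractClosure N), Nonempty ((relYoneda X).obj N ≅ K.X k))
    (hK' : ∀ k, K.ExactAt (k + 1)) (m k : ℕ) (hm : ∀ i, m + k ≤ i → IsZero (K.X i)) :
    HasRes X m (K.opcycles k) := by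
  induction m generalizing k with
  | zero =>
    exact IsZero.of_epi (K.pOpcycles k) (hm k (by simp))
  | succ m ih =>
    obtain ⟨N, hN, ⟨e⟩⟩ := hK k
    exact HasRes.of_shortExact (opcycles_shortExact K k (hK' k)) hN e
      (ih (k + 1) fun i hi => hm i (by lia))

variable [X.ContainsZero]

/-- A projective `P` is a retract of a representable functor. The corresponding idempotent of `X₀`
splits in the abelian category `A`, though perhaps not in `X`; hence `retractClosure`. -/
theorem FPMod.exists_relYoneda_iso_of_projective (P : FPMod X.FullSubcategory) [Projective P] :
    ∃ (N : A) (_ : X.retractClosure N), Nonempty ((relYoneda X).obj N ≅ P.obj) := by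
  obtain ⟨_, _, X₀, _, p, _, _, hp⟩ := P.property
  let q : FPMod.rep X₀ ⟶ P := ObjectProperty.homMk p
  have : Epi ((FPMod.ι _).map q) := hp
  have : Epi q := (FPMod.ι _).epi_of_epi_map this
  let s : P.obj ⟶ preadditiveYoneda.obj X₀ := (Projective.factorThru (𝟙 P) q).hom
  have hs : s ≫ p = 𝟙 P.obj :=
    congrArg InducedCategory.Hom.hom (Projective.factorThru_comp (𝟙 P) q)
  obtain ⟨e, he⟩ := preadditiveYoneda.map_surjective (p ≫ s)
  have he' : e ≫ e = e := preadditiveYoneda.map_injective (by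
    rw [Functor.map_comp, he, Category.assoc, reassoc_of% hs])
  obtain ⟨N, i, r, hir, hri⟩ := IsIdempotentComplete.idempotents_split X₀.obj e.hom
    (congrArg InducedCategory.Hom.hom he')
  refine ⟨N, ⟨X₀.obj, X₀.property, ⟨⟨i, r, hir⟩⟩⟩, ⟨?_⟩⟩
  have h := relYonedaIso_naturality X e
  rw [he, ← hri, ← Category.assoc, ← Iso.eq_comp_inv, Category.assoc, Category.assoc] at h
  refine
    { hom := (relYoneda X).map i ≫ (relYonedaIso X X₀).hom ≫ p
      inv := s ≫ (relYonedaIso X X₀).inv ≫ (relYoneda X).map r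
      hom_inv_id := ?_
      inv_hom_id := ?_ }
  · simp only [Category.assoc]
    rw [← reassoc_of% h]
    simp only [← Functor.map_comp, Category.assoc, hir, Category.comp_id]
    exact CategoryTheory.Functor.map_id _ _
  · simp only [Category.assoc]
    rw [← Functor.map_comp_assoc, h]
    simp [hs]

variable [X.IsClosedUnderBinaryProducts]

instance : HasBinaryBiproducts X.FullSubcategory :=
  HasBinaryBiproducts.of_hasBinaryProducts

theorem HasRes.of_projectiveResolution {F : FPMod X.FullSubcategory} (P : ProjectiveResolution F)
    {n : ℕ} (hn : ∀ i, n < i → IsZero (P.complex.X i)) : HasRes X (n + 1) F.obj := by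
  let K := ((FPMod.ι X.FullSubcategory).mapHomologicalComplex _).obj P.complex
  -- `HasRes` counts terms: degrees `0` to `n` contribute `n + 1`.
  have h : HasRes X (n + 1) (K.opcycles 0) := by
    refine HasRes.opcycles K (fun k => ?_) (fun k => ?_) _ _ (fun i hi => ?_)
    · exact FPMod.exists_relYoneda_iso_of_projective (P.complex.X k)
    · exact (P.complex_exactAt_succ k).map (FPMod.ι X.FullSubcategory)
    · exact (FPMod.ι X.FullSubcategory).map_isZero (hn i (by lia))
  have hc := CokernelCofork.mapIsColimit _ P.isColimitCokernelCofork (FPMod.ι X.FullSubcategory)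
  exact h.of_iso ((K.opcyclesIsCokernel 1 0 (by simp)).coconePointUniqueUpToIso hc)

end RelativeResolutions

/-! ### Homotopy classes of maps out of a single object. -/

section HomotopyCategorySingle

variable {A : Type u} [Category.{v} A] [Abelian A]

/-- The homotopy category of cochain complexes. -/
abbrev HoCat (A : Type u) [Category.{v} A] [Abelian A] := HomotopyCategory A (ComplexShape.up ℤ)

/-- The functor to the homotopy category placing an object in degree `j`. -/
abbrev hoSingle (A : Type u) [Category.{v} A] [Abelian A] (j : ℤ) : A ⥤ HoCat A :=
  HomotopyCategory.singleFunctor A j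

theorem hoSingle_hom_eq_map {N : A} {j : ℤ} {L : CochainComplex A ℤ}
    (g : (hoSingle A j).obj N ⟶ (HomotopyCategory.quotient A (.up ℤ)).obj L) :
    ∃ f : (HomologicalComplex.single A (.up ℤ) j).obj N ⟶ L,
      (HomotopyCategory.quotient A (.up ℤ)).map f = g :=
  (HomotopyCategory.quotient A (.up ℤ)).map_surjective g

theorem hoSingle_hom_eq_zero {N : A} {j : ℤ} {L : CochainComplex A ℤ} (hL : IsZero (L.X j))
    (g : (hoSingle A j).obj N ⟶ (HomotopyCategory.quotient A (.up ℤ)).obj L) : g = 0 := by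
  obtain ⟨f, rfl⟩ := hoSingle_hom_eq_map g
  rw [show f = 0 from HomologicalComplex.from_single_hom_ext (hL.eq_of_tgt _ _)]
  exact Functor.map_zero _ _ _

theorem hoSingle_hom_hoSingle_eq_zero {N N' : A} {j i : ℤ} (h : j ≠ i)
    (g : (hoSingle A j).obj N ⟶ (hoSingle A i).obj N') : g = 0 :=
  hoSingle_hom_eq_zero (L := (HomologicalComplex.single A (.up ℤ) i).obj N')
    (HomologicalComplex.isZero_single_obj_X _ _ _ _ h) g

instance (j : ℤ) : (hoSingle A j).Full where
  map_surjective g := by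
    obtain ⟨f, hf⟩ := hoSingle_hom_eq_map
      (L := (HomologicalComplex.single A (.up ℤ) _).obj _) g
    obtain ⟨a, rfl⟩ := (HomologicalComplex.single A (.up ℤ) j).map_surjective f
    exact ⟨a, hf⟩

instance (j : ℤ) : (hoSingle A j).Faithful where
  map_injective {N N' a b} h := by
    have H := HomotopyCategory.homotopyOfEq
      ((HomologicalComplex.single A (.up ℤ) j).map a)
      ((HomologicalComplex.single A (.up ℤ) j).map b) h
    apply (HomologicalComplex.single A (.up ℤ) j).map_injective
    apply HomologicalComplex.from_single_hom_ext
    -- Both homotopy terms contain a differential of a complex concentrated in degree `j`, hence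
    -- vanish.
    rw [H.comm j, dNext_eq H.hom (show (ComplexShape.up ℤ).Rel j (j + 1) from rfl),
      prevD_eq H.hom (show (ComplexShape.up ℤ).Rel (j - 1) j by simp)]
    simp

/-- A cocycle gives a morphism in the homotopy category. -/
def hoSingleDesc {L : CochainComplex A ℤ} {N : A} {j : ℤ} (z : N ⟶ L.X j)
    (hz : z ≫ L.d j (j + 1) = 0) :
    (hoSingle A j).obj N ⟶ (HomotopyCategory.quotient A (.up ℤ)).obj L :=
  (HomotopyCategory.quotient A (.up ℤ)).map (HomologicalComplex.mkHomFromSingle z (by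
    rintro k rfl
    exact hz))

theorem hoSingleDesc_surjective {L : CochainComplex A ℤ} {N : A} {j : ℤ}
    (g : (hoSingle A j).obj N ⟶ (HomotopyCategory.quotient A (.up ℤ)).obj L) :
    ∃ (z : N ⟶ L.X j) (hz : z ≫ L.d j (j + 1) = 0), hoSingleDesc z hz = g := by
  obtain ⟨f, rfl⟩ := hoSingle_hom_eq_map g
  refine ⟨(HomologicalComplex.singleObjXSelf _ j N).inv ≫ f.f j, by simp, ?_⟩
  refine congrArg _ (HomologicalComplex.from_single_hom_ext ?_)
  simp

theorem hoSingle_map_desc {L : CochainComplex A ℤ} {N N' : A} {j : ℤ} (a : N' ⟶ N) (z : N ⟶ L.X j)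
    (hz : z ≫ L.d j (j + 1) = 0) :
    (hoSingle A j).map a ≫ hoSingleDesc z hz =
      hoSingleDesc (a ≫ z) (by rw [Category.assoc, hz, comp_zero]) := by
  refine ((HomotopyCategory.quotient A (.up ℤ)).map_comp _ _).symm.trans
    (congrArg _ (HomologicalComplex.from_single_hom_ext ?_))
  change ((HomologicalComplex.single A (.up ℤ) j).map a).f j ≫ _ = _
  simp [HomologicalComplex.single_map_f_self]

theorem exists_of_hoSingleDesc_eq_zero {L : CochainComplex A ℤ} {N : A} {j : ℤ} {z : N ⟶ L.X j}
    {hz : z ≫ L.d j (j + 1) = 0} (h : hoSingleDesc z hz = 0) :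
    ∃ y : N ⟶ L.X (j - 1), y ≫ L.d (j - 1) j = z := by
  have h₀ : (HomotopyCategory.quotient A (.up ℤ)).map
      (0 : (HomologicalComplex.single A (.up ℤ) j).obj N ⟶ L) = 0 := Functor.map_zero _ _ _
  have H := HomotopyCategory.homotopyOfEq _ _ (h.trans h₀.symm)
  obtain ⟨t, ht⟩ : ∃ t : ((HomologicalComplex.single A (.up ℤ) j).obj N).X j ⟶ L.X (j - 1),
      (HomologicalComplex.singleObjXSelf _ j N).hom ≫ z = t ≫ L.d (j - 1) j := by
    have := H.comm j
    rw [dNext_eq H.hom (show (ComplexShape.up ℤ).Rel j (j + 1) from rfl),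
      prevD_eq H.hom (show (ComplexShape.up ℤ).Rel (j - 1) j by simp),
      HomologicalComplex.mkHomFromSingle_f, CochainComplex.singleFunctor_obj_d, zero_comp,
      zero_add] at this
    exact ⟨H.hom j (j - 1), this.trans (add_zero _)⟩
  refine ⟨(HomologicalComplex.singleObjXSelf _ j N).inv ≫ t, ?_⟩
  rw [Category.assoc, ← ht, Iso.inv_hom_id_assoc]

variable {X : ObjectProperty A}

/-- Maps out of an object in degree `j` are represented by maps into the `j`-cycles, so an
approximation of the cycles suffices. -/
theorem exists_hoSingle_approximation (hfin : IsContravariantlyFinite X) (M : HoCat A) (j : ℤ) :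
    ∃ (X₀ : A) (_ : X X₀) (φ : (hoSingle A j).obj X₀ ⟶ M),
      ∀ (X' : A) (_ : X X') (g : (hoSingle A j).obj X' ⟶ M),
        ∃ h : X' ⟶ X₀, (hoSingle A j).map h ≫ φ = g := by
  obtain ⟨L, rfl⟩ : ∃ L, (HomotopyCategory.quotient A (.up ℤ)).obj L = M := ⟨M.as, rfl⟩
  obtain ⟨X₀, hX₀, f, hf⟩ := hfin (kernel (L.d j (j + 1)))
  refine ⟨X₀, hX₀, hoSingleDesc (f ≫ kernel.ι _) (by simp), fun X' hX' g => ?_⟩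
  obtain ⟨z, hz, rfl⟩ := hoSingleDesc_surjective g
  obtain ⟨h, hh⟩ := hf X' hX' (kernel.lift _ z hz)
  refine ⟨h, ?_⟩
  rw [hoSingle_map_desc]
  congr 1
  rw [reassoc_of% hh, kernel.lift_ι]

/-- A generalized cycle `N ⟶ L.X j` becomes a boundary after pulling back along an epimorphism from
`X`, which is exactness up to refinements. -/
theorem acyclic_of_forall_hoSingle_hom_eq_zero (hgen : Generates X) (L : CochainComplex A ℤ)
    (h : ∀ (j : ℤ) (X' : A) (_ : X X')
      (g : (hoSingle A j).obj X' ⟶ (HomotopyCategory.quotient A (.up ℤ)).obj L), g = 0) :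
    L.Acyclic := by
  intro j
  rw [HomologicalComplex.exactAt_iff' L (j - 1) j (j + 1) (by simp) (by simp),
    ShortComplex.exact_iff_exact_up_to_refinements]
  intro N (z : N ⟶ L.X j) (hz : z ≫ L.d j (j + 1) = 0)
  obtain ⟨X₀, hX₀, π, hπ⟩ := hgen N
  obtain ⟨y, hy⟩ := exists_of_hoSingleDesc_eq_zero
    (h j X₀ hX₀ (hoSingleDesc (π ≫ z) (by
      rw [Category.assoc, hz, comp_zero])))
  exact ⟨X₀, π, hπ, y, hy.symm⟩

open ZeroObject in
theorem isZero_Qh_obj [HasDerivedCategory.{w} A] (hgen : Generates X) (M : HoCat A)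
    (h : ∀ (j : ℤ) (X' : A) (_ : X X') (g : (hoSingle A j).obj X' ⟶ M), g = 0) :
    IsZero (DerivedCategory.Qh.obj M) := by
  have hM := acyclic_of_forall_hoSingle_hom_eq_zero hgen M.as h
  have : QuasiIso (0 : M.as ⟶ 0) := ⟨fun j => by
    rw [quasiIsoAt_iff_exactAt']
    · exact hM j
    · exact (HomologicalComplex.exactAt_iff_isZero_homology _ _).2
        ((HomologicalComplex.homologyFunctor A _ j).map_isZero (isZero_zero _))⟩
  have := (DerivedCategory.isIso_Q_map_iff_quasiIso A (0 : M.as ⟶ 0)).2 this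
  have hz : IsZero (DerivedCategory.Q.obj M.as) :=
    (DerivedCategory.Q.map_isZero (isZero_zero _)).of_iso
      (asIso (DerivedCategory.Q.map (0 : M.as ⟶ 0)))
  exact hz.of_iso ((DerivedCategory.quotientCompQhIso A).app M.as)

end HomotopyCategorySingle

/-! ### The cohomology functors relative to `X` and syzygies of complexes. -/

section RelativeCohomology

open Pretriangulated

variable {A : Type u} [Category.{v} A] [Abelian A] (X : ObjectProperty A)

/-- The functor sending a complex `M` to the contravariant functor on `X` given by homotopy classes
of maps from objects placed in degree `j`; that is, the `j`-th cohomology of `Hom(-, M)`. -/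
def hoHom (j : ℤ) : HoCat A ⥤ X.FullSubcategoryᵒᵖ ⥤ AddCommGrpCat.{v} :=
  preadditiveYoneda ⋙ (Functor.whiskeringLeft _ _ _).obj (X.ι ⋙ hoSingle A j).op

instance (j : ℤ) (M : HoCat A) : ((hoHom X j).obj M).Additive :=
  inferInstanceAs ((X.ι ⋙ hoSingle A j).op ⋙ preadditiveYoneda.obj M).Additive

instance (j : ℤ) : (hoHom X j).Additive where
  map_add {M M' φ ψ} := by
    ext Y (f : (hoSingle A j).obj Y.unop.obj ⟶ M)
    exact Preadditive.comp_add _ _ _ f φ ψ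

/-- The morphism from a restricted representable functor given by a morphism from an object
placed in degree `j`. -/
def hoHomDesc {j : ℤ} {N : A} {M : HoCat A} (φ : (hoSingle A j).obj N ⟶ M) :
    (relYoneda X).obj N ⟶ (hoHom X j).obj M where
  app Y := AddCommGrpCat.ofHom (AddMonoidHom.mk'
    (fun (f : Y.unop.obj ⟶ N) => ((hoSingle A j).map f ≫ φ : (hoSingle A j).obj Y.unop.obj ⟶ M))
    (fun (f g : Y.unop.obj ⟶ N) => by
      change (hoSingle A j).map (f + g) ≫ φ = _
      rw [Functor.map_add, Preadditive.add_comp]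
      rfl))
  naturality Y Z a := by
    ext (f : Y.unop.obj ⟶ N)
    change (hoSingle A j).map (a.unop.hom ≫ f) ≫ φ =
      (hoSingle A j).map a.unop.hom ≫ (hoSingle A j).map f ≫ φ
    rw [Functor.map_comp, Category.assoc]

variable {X}

theorem hoHomDesc_comp {j : ℤ} {N : A} {M M' : HoCat A} (φ : (hoSingle A j).obj N ⟶ M)
    (ψ : M ⟶ M') : hoHomDesc X φ ≫ (hoHom X j).map ψ = hoHomDesc X (φ ≫ ψ) := by
  ext Y (f : Y.unop.obj ⟶ N)
  change ((hoSingle A j).map f ≫ φ) ≫ ψ = (hoSingle A j).map f ≫ φ ≫ ψ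
  rw [Category.assoc]

theorem exists_hoHomDesc_eq {j : ℤ} {N : A} (hN : X.retractClosure N) {M : HoCat A}
    (p : (relYoneda X).obj N ⟶ (hoHom X j).obj M) :
    ∃ φ : (hoSingle A j).obj N ⟶ M, hoHomDesc X φ = p := by
  obtain ⟨X₀, hX₀, ⟨⟨i, r, hir⟩⟩⟩ := hN
  let φ₀ : (hoSingle A j).obj X₀ ⟶ M := p.app (.op ⟨X₀, hX₀⟩) r
  refine ⟨(hoSingle A j).map i ≫ φ₀, ?_⟩
  ext Y (f : Y.unop.obj ⟶ N)
  let a : Y.unop ⟶ ⟨X₀, hX₀⟩ := ObjectProperty.homMk (f ≫ i)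
  have h : p.app Y ((f ≫ i) ≫ r) = (hoSingle A j).map (f ≫ i) ≫ φ₀ :=
    ConcreteCategory.congr_hom (p.naturality a.op) r
  rw [Category.assoc, hir, Category.comp_id] at h
  change (hoSingle A j).map f ≫ (hoSingle A j).map i ≫ φ₀ = p.app Y f
  rw [h, Functor.map_comp, Category.assoc]

/-- Approximating `M` gives the generators; approximating the cocone `W` of that approximation gives
the relations. -/
theorem isFinitelyPresented_hoHom (hfin : IsContravariantlyFinite X) (M : HoCat A) (j : ℤ) :
    IsFinitelyPresented ((hoHom X j).obj M) := by
  obtain ⟨X₀, hX₀, φ, hφ⟩ := exists_hoSingle_approximation hfin M j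
  obtain ⟨W, α, δ, hT⟩ := distinguished_cocone_triangle₁ φ
  obtain ⟨X₁, hX₁, ψ, hψ⟩ := exists_hoSingle_approximation hfin W j
  obtain ⟨a, ha⟩ := (hoSingle A j).map_surjective (ψ ≫ α)
  let a' : (⟨X₁, hX₁⟩ : X.FullSubcategory) ⟶ ⟨X₀, hX₀⟩ := ObjectProperty.homMk a
  have hαφ : α ≫ φ = 0 := comp_distTriang_mor_zero₁₂ _ hT
  have w : preadditiveYoneda.map a' ≫ (relYonedaIso X _).inv ≫ hoHomDesc X φ = 0 := by
    apply preadditiveYoneda_hom_ext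
    change (hoSingle A j).map (𝟙 X₁ ≫ a) ≫ φ = 0
    rw [Category.id_comp, ha, Category.assoc, hαφ, comp_zero]
  refine ⟨inferInstance, ⟨X₁, hX₁⟩, ⟨X₀, hX₀⟩, a', (relYonedaIso X _).inv ≫ hoHomDesc X φ, w,
    ?_, ?_⟩
  · rw [exact_iff_pointwise]
    rintro ⟨Z⟩ (f : Z ⟶ _) (hf : (hoSingle A j).map f.hom ≫ φ = 0)
    obtain ⟨g, hg⟩ := Triangle.coyoneda_exact₂ _ hT ((hoSingle A j).map f.hom) hf
    obtain ⟨h, rfl⟩ := hψ _ Z.property g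
    refine ⟨ObjectProperty.homMk h, ?_⟩
    apply ObjectProperty.hom_ext
    apply (hoSingle A j).map_injective
    change (hoSingle A j).map (h ≫ a) = (hoSingle A j).map f.hom
    refine Eq.trans ?_ hg.symm
    rw [Functor.map_comp, ha]
    exact (Category.assoc _ _ _).symm
  · rw [epi_iff_pointwise]
    rintro ⟨Z⟩ (g : (hoSingle A j).obj Z.obj ⟶ M)
    obtain ⟨h, hh⟩ := hφ _ Z.property g
    exact ⟨ObjectProperty.homMk h, hh⟩

/-- Surjectivity of `φ` in degree `j - 1` kills the connecting map into degree `j`, so the long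
exact sequence breaks into short ones. -/
theorem hoHom_shortExact {W Q M : HoCat A} {α : W ⟶ Q} {φ : Q ⟶ M} {δ : M ⟶ W⟦(1 : ℤ)⟧}
    (hT : Triangle.mk α φ δ ∈ distTriang (HoCat A)) (hφ : ∀ j, Epi ((hoHom X j).map φ)) (j : ℤ)
    (w : (hoHom X j).map α ≫ (hoHom X j).map φ = 0) :
    (ShortComplex.mk _ _ w).ShortExact := by
  refine { exact := ?_, mono_f := ?_, epi_g := hφ j }
  · rw [exact_iff_pointwise]
    rintro ⟨Z⟩ (f : (hoSingle A j).obj Z.obj ⟶ Q) (hf : f ≫ φ = 0)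
    obtain ⟨g, hg⟩ := Triangle.coyoneda_exact₂ _ hT f hf
    exact ⟨g, hg.symm⟩
  · rw [mono_iff_pointwise]
    rintro ⟨Z⟩
    refine (injective_iff_map_eq_zero ((hoHom X j).map α |>.app (.op Z)).hom).2 ?_
    rintro (g : (hoSingle A j).obj Z.obj ⟶ W) (hg : g ≫ α = 0)
    change g = 0
    let e : ((hoSingle A j).obj Z.obj)⟦(1 : ℤ)⟧ ≅ (hoSingle A (j - 1)).obj Z.obj :=
      ((HomotopyCategory.singleFunctors A).shiftIso 1 (j - 1) j (by simp)).app Z.obj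
    -- An element killed by `α` factors, after a shift, as `k` followed by `δ`; lifting `k` through
    -- `φ` makes it zero because `φ ≫ δ = 0`.
    obtain ⟨k, hk⟩ := Triangle.coyoneda_exact₁ _ hT (e.inv ≫ g⟦(1 : ℤ)⟧') (by
      rw [Category.assoc]
      refine (congrArg _ ((Functor.map_comp _ _ _).symm.trans (congrArg _ hg))).trans ?_
      rw [Functor.map_zero]
      exact comp_zero)
    obtain ⟨l, rfl⟩ := (epi_iff_pointwise _).1 (hφ (j - 1)) (.op Z) k
    change (hoSingle A (j - 1)).obj Z.obj ⟶ Q at l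
    have h0 : e.inv ≫ g⟦(1 : ℤ)⟧' = 0 := by
      refine hk.trans ((Category.assoc l φ δ).trans ?_)
      rw [show φ ≫ δ = 0 from comp_distTriang_mor_zero₂₃ _ hT, comp_zero]
    apply (shiftFunctor (HoCat A) (1 : ℤ)).map_injective
    rw [Functor.map_zero, ← cancel_epi e.inv, h0, comp_zero]

/-- There are no nonzero maps between objects in distinct degrees, so only the `j`-th summand
contributes. -/
theorem isIso_hoHomDesc_biproduct {s : Finset ℤ} (N : s → A) (j : s) :
    IsIso (hoHomDesc X (biproduct.ι (fun i : s => (hoSingle A i).obj (N i)) j)) := by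
  have : Mono (hoHomDesc X (biproduct.ι (fun i : s => (hoSingle A i).obj (N i)) j)) := by
    rw [mono_iff_pointwise]
    rintro ⟨Z⟩ (f : Z.obj ⟶ N j) (g : Z.obj ⟶ N j) hfg
    change (hoSingle A j).map f ≫ biproduct.ι (fun i : s => (hoSingle A i).obj (N i)) j =
      (hoSingle A j).map g ≫ biproduct.ι (fun i : s => (hoSingle A i).obj (N i)) j at hfg
    rw [cancel_mono] at hfg
    exact (hoSingle A j).map_injective hfg
  have : Epi (hoHomDesc X (biproduct.ι (fun i : s => (hoSingle A i).obj (N i)) j)) := by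
    rw [epi_iff_pointwise]
    rintro ⟨Z⟩ (f : (hoSingle A j).obj Z.obj ⟶ ⨁ fun i : s => (hoSingle A i).obj (N i))
    obtain ⟨a, ha⟩ := (hoSingle A j).map_surjective (f ≫ biproduct.π _ j)
    refine ⟨a, ?_⟩
    change (hoSingle A j).map a ≫ biproduct.ι (fun i : s => (hoSingle A i).obj (N i)) j = f
    apply biproduct.hom_ext
    intro i
    by_cases h : j = i
    · subst h
      simp [ha]
    · rw [hoSingle_hom_hoSingle_eq_zero (fun h' => h (Subtype.ext h')) (f ≫ biproduct.π _ i)]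
      exact hoSingle_hom_hoSingle_eq_zero (fun h' => h (Subtype.ext h')) _
  exact isIso_of_mono_of_epi _

theorem isZero_hoHom_biproduct {s : Finset ℤ} (N : s → A) {j : ℤ} (hj : j ∉ s) :
    IsZero ((hoHom X j).obj (⨁ fun i : s => (hoSingle A i).obj (N i))) := by
  rw [Functor.isZero_iff]
  rintro ⟨Z⟩
  refine @AddCommGrpCat.isZero_of_subsingleton _ ⟨?_⟩
  rintro (f : (hoSingle A j).obj Z.obj ⟶ ⨁ fun i : s => (hoSingle A i).obj (N i))
    (g : (hoSingle A j).obj Z.obj ⟶ ⨁ fun i : s => (hoSingle A i).obj (N i))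
  apply biproduct.hom_ext
  intro i
  have h : j ≠ i := by
    rintro rfl
    exact hj i.2
  rw [hoSingle_hom_hoSingle_eq_zero h (f ≫ biproduct.π _ i),
    hoSingle_hom_hoSingle_eq_zero h (g ≫ biproduct.π _ i)]

theorem exists_syzygy_triangle {n : ℕ} {M : HoCat A} {s : Finset ℤ}
    (hM : ∀ j ∈ s, HasRes X (n + 1) ((hoHom X j).obj M))
    (hM' : ∀ j ∉ s, IsZero ((hoHom X j).obj M)) :
    ∃ (N : s → A) (_ : ∀ j, X.retractClosure (N j)) (W : HoCat A)
      (α : W ⟶ ⨁ fun i : s => (hoSingle A i).obj (N i))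
      (φ : (⨁ fun i : s => (hoSingle A i).obj (N i)) ⟶ M) (δ : M ⟶ W⟦(1 : ℤ)⟧),
      Triangle.mk α φ δ ∈ distTriang (HoCat A) ∧
      (∀ j ∈ s, HasRes X n ((hoHom X j).obj W)) ∧
      ∀ j ∉ s, IsZero ((hoHom X j).obj W) := by
  choose N hN p hp hres using fun j : s => hM j j.2
  choose φ hφ using fun j : s => exists_hoHomDesc_eq (hN j) (p j)
  obtain ⟨W, α, δ, hT⟩ := distinguished_cocone_triangle₁
    (biproduct.desc φ : (⨁ fun i : s => (hoSingle A i).obj (N i)) ⟶ M)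
  have hι : ∀ j : s, hoHomDesc X (biproduct.ι (fun i : s => (hoSingle A i).obj (N i)) j) ≫
      (hoHom X j).map (biproduct.desc φ) = p j := fun j => by
    rw [hoHomDesc_comp, biproduct.ι_desc, hφ]
  have hepi : ∀ j, Epi ((hoHom X j).map (biproduct.desc φ)) := fun j => by
    by_cases hj : j ∈ s
    · have := hp ⟨j, hj⟩
      exact epi_of_epi_fac (hι ⟨j, hj⟩)
    · exact ⟨fun _ _ _ => (hM' j hj).eq_of_src _ _⟩
  have hw : ∀ j, (hoHom X j).map α ≫ (hoHom X j).map (biproduct.desc φ) = 0 := fun j => by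
    rw [← Functor.map_comp, show α ≫ biproduct.desc φ = 0 from comp_distTriang_mor_zero₁₂ _ hT,
      Functor.map_zero]
  have hS := fun j => hoHom_shortExact hT hepi j (hw j)
  refine ⟨N, hN, W, α, biproduct.desc φ, δ, hT, fun j hj => ?_, fun j hj => ?_⟩
  · have := isIso_hoHomDesc_biproduct (X := X) N ⟨j, hj⟩
    have := (hS j).mono_f
    refine (hres ⟨j, hj⟩).of_iso ?_
    exact kernelIsoOfEq (hι ⟨j, hj⟩).symm ≪≫ kernelIsIsoComp _ _ ≪≫
      (kernelIsKernel _).conePointUniqueUpToIso (hS j).exact.fIsKernel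
  · have := (hS j).mono_f
    exact IsZero.of_mono ((hoHom X j).map α) (isZero_hoHom_biproduct N hj)

end RelativeCohomology

/-! ### Passage to the bounded derived category and induction on the length. -/

section BoundedDerived

open Pretriangulated

variable {A : Type u} [Category.{v} A] [Abelian A] [HasDerivedCategory.{w} A]
  {X : ObjectProperty A}

/-- An object placed in degree `j`, as an object of the bounded derived category. -/
def boundedSingle (j : ℤ) (N : A) : DerivedCategory.Bounded A :=
  ⟨(DerivedCategory.singleFunctor A j).obj N, ⟨⟨j, inferInstance⟩, ⟨j, inferInstance⟩⟩⟩

/-- Retracts placed in the same degree. -/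
def boundedSingleRetract (j : ℤ) {N N' : A} (r : Retract N N') :
    Retract (boundedSingle.{w} j N) (boundedSingle j N') where
  i := ObjectProperty.homMk ((DerivedCategory.singleFunctor A j).map r.i)
  r := ObjectProperty.homMk ((DerivedCategory.singleFunctor A j).map r.r)
  retract := ObjectProperty.hom_ext _ (by
    change (DerivedCategory.singleFunctor A j).map r.i ≫
      (DerivedCategory.singleFunctor A j).map r.r = 𝟙 _
    rw [← Functor.map_comp, r.retract, CategoryTheory.Functor.map_id])

theorem shiftClosure_boundedSingle (j : ℤ) {N : A} (hN : X N) :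
    ((inDegreeZero.{w} X).shiftClosure ℤ) (boundedSingle j N) := by
  refine ⟨boundedSingle 0 N, -j, (DerivedCategory.TStructure.t.bounded).fullyFaithfulι.preimageIso
    ?_, N, hN, ⟨Iso.refl _⟩⟩
  exact (((DerivedCategory.singleFunctors A).shiftIso (-j) j 0 (by simp)).app N).symm ≪≫
    (((DerivedCategory.Bounded.ι (C := A)).commShiftIso (-j)).app (boundedSingle 0 N)).symm

theorem triangEnvelopeIter_zero_biproduct [X.ContainsZero] {s : Finset ℤ} (N : s → A)
    (hN : ∀ j, X.retractClosure (N j)) :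
    (inDegreeZero.{w} X).triangEnvelopeIter 0 (⨁ fun j : s => boundedSingle j (N j)) := by
  rw [ObjectProperty.triangEnvelopeIter_zero]
  choose N' hN' r using hN
  -- The zero object covers the empty biproduct, where closure under binary products is not enough.
  have hz : ((inDegreeZero.{w} X).shiftClosure ℤ).binaryProductsClosure.ContainsZero := by
    obtain ⟨Z, hZ, hZ'⟩ := X.exists_prop_of_containsZero
    refine ⟨boundedSingle 0 Z, ?_,
      ObjectProperty.le_limitsClosure _ _ _ (shiftClosure_boundedSingle 0 hZ')⟩
    exact IsZero.of_full_of_faithful_of_isZero (DerivedCategory.Bounded.ι (C := A)) _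
      ((DerivedCategory.singleFunctor A 0).map_isZero hZ)
  have : ((inDegreeZero.{w} X).shiftClosure ℤ).binaryProductsClosure.IsClosedUnderFiniteProducts :=
    .mk'
  refine ⟨⨁ fun j : s => boundedSingle j (N' j), ?_, ⟨?_⟩⟩
  · exact ObjectProperty.prop_of_isLimit_fan _ (biproduct.isLimit _) fun j =>
      ObjectProperty.le_limitsClosure _ _ _ (shiftClosure_boundedSingle (j : ℤ) (hN' j))
  · have r' := fun j : s => boundedSingleRetract.{w} (j : ℤ) (r j).some
    exact
      { i := biproduct.map fun j => (r' j).i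
        r := biproduct.map fun j => (r' j).r
        retract := by
          refine biproduct.hom_ext _ _ fun j => ?_
          simp }

/-- The image in the derived category of a finite biproduct of objects placed in single degrees. -/
def boundedBiproductIso {s : Finset ℤ} (N : s → A) :
    (⨁ fun j : s => boundedSingle.{w} j (N j)).obj ≅
      DerivedCategory.Qh.obj (⨁ fun j : s => (hoSingle A j).obj (N j)) :=
  ((DerivedCategory.Bounded.ι (C := A)).mapBiproduct _) ≪≫
    biproduct.mapIso (fun j : s =>
      ((SingleFunctors.evaluation _ _ (j : ℤ)).mapIso
        (DerivedCategory.singleFunctorsPostcompQhIso A)).app (N j)) ≪≫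
    (DerivedCategory.Qh.mapBiproduct (fun j : s => (hoSingle A j).obj (N j))).symm

theorem triangEnvelopeIter_of_hasRes [X.ContainsZero] (hgen : Generates X) (n : ℕ) (M : HoCat A)
    (s : Finset ℤ) (hM : ∀ j ∈ s, HasRes X (n + 1) ((hoHom X j).obj M))
    (hM' : ∀ j ∉ s, IsZero ((hoHom X j).obj M)) (B : DerivedCategory.Bounded A)
    (e : B.obj ≅ DerivedCategory.Qh.obj M) :
    (inDegreeZero.{w} X).triangEnvelopeIter n B := by
  induction n generalizing M B with
  | zero =>
    obtain ⟨N, hN, W, α, φ, δ, hT, hW, hW'⟩ := exists_syzygy_triangle hM hM'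
    have hW₀ : IsZero (DerivedCategory.Qh.obj W) := by
      refine isZero_Qh_obj hgen W fun j Z hZ g => ?_
      have h : IsZero ((hoHom X j).obj W) := by
        by_cases hj : j ∈ s
        · exact hW j hj
        · exact hW' j hj
      have := AddCommGrpCat.subsingleton_of_isZero ((Functor.isZero_iff _).1 h (.op ⟨Z, hZ⟩))
      exact Subsingleton.elim (α := ((hoHom X j).obj W).obj (.op ⟨Z, hZ⟩)) g 0
    have : IsIso (DerivedCategory.Qh.map φ) :=
      (Triangle.isZero₁_iff_isIso₂ _ (DerivedCategory.Qh.map_distinguished _ hT)).1 hW₀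
    exact ObjectProperty.prop_of_iso _
      ((DerivedCategory.TStructure.t.bounded).fullyFaithfulι.preimageIso
        (boundedBiproductIso N ≪≫ asIso (DerivedCategory.Qh.map φ) ≪≫ e.symm))
      (triangEnvelopeIter_zero_biproduct N hN)
  | succ n ih =>
    obtain ⟨N, hN, W, α, φ, δ, hT, hW, hW'⟩ := exists_syzygy_triangle hM hM'
    let φ' : (⨁ fun j : s => boundedSingle.{w} j (N j)) ⟶ B :=
      ObjectProperty.homMk ((boundedBiproductIso N).hom ≫ DerivedCategory.Qh.map φ ≫ e.inv)
    -- The cone is formed among bounded objects, so no boundedness of `W` has to be checked;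
    -- comparing triangles identifies it with the image of `W⟦1⟧`.
    obtain ⟨Z, g, h, hZ⟩ := distinguished_cocone_triangle φ'
    let eT := isoTriangleOfIso₁₂ _ _
      ((DerivedCategory.Bounded.ι (C := A)).map_distinguished _ hZ)
      (DerivedCategory.Qh.map_distinguished _ (rot_of_distTriang _ hT))
      (boundedBiproductIso N) e (by
        change ((boundedBiproductIso N).hom ≫ DerivedCategory.Qh.map φ ≫ e.inv) ≫ e.hom =
          (boundedBiproductIso N).hom ≫ DerivedCategory.Qh.map φ
        simp)
    let eZ : Z.obj ≅ DerivedCategory.Qh.obj (W⟦(1 : ℤ)⟧) := Triangle.π₃.mapIso eT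
    have h₁ : (inDegreeZero.{w} X).triangEnvelopeIter n (Z⟦(-1 : ℤ)⟧) := by
      refine ih W hW hW' _ ?_
      exact ((DerivedCategory.Bounded.ι (C := A)).commShiftIso (-1 : ℤ)).app Z ≪≫
        (shiftFunctor _ (-1 : ℤ)).mapIso eZ ≪≫
        ((DerivedCategory.Qh.commShiftIso (-1 : ℤ)).app _).symm ≪≫
        DerivedCategory.Qh.mapIso (shiftShiftNeg W (1 : ℤ))
    have h₂ : (inDegreeZero.{w} X).triangEnvelopeIter n Z :=
      ObjectProperty.prop_of_iso _ (shiftNegShift Z (1 : ℤ))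
        (ObjectProperty.IsStableUnderShiftBy.le_shift (a := (1 : ℤ)) _ h₁)
    rw [ObjectProperty.triangEnvelopeIter_succ]
    refine ObjectProperty.le_retractClosure _ _ ⟨_, _, φ', g, h, hZ, ?_, h₂⟩
    have := triangEnvelopeIter_zero_biproduct.{w} N hN
    rwa [ObjectProperty.triangEnvelopeIter_zero] at this

/-- A strictly bounded representative receives only zero maps from objects placed outside its range
of degrees. -/
theorem exists_iso_Qh_of_bounded (B : DerivedCategory.Bounded A) :
    ∃ (M : HoCat A) (s : Finset ℤ) (_ : ∀ j ∉ s, IsZero ((hoHom X j).obj M)),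
      Nonempty (B.obj ≅ DerivedCategory.Qh.obj M) := by
  obtain ⟨⟨a, ha⟩, ⟨b, hb⟩⟩ := B.property
  obtain ⟨L, _, _, ⟨e⟩⟩ := DerivedCategory.exists_iso_Q_obj_of_isGE_of_isLE B.obj a b
  refine ⟨(HomotopyCategory.quotient A (.up ℤ)).obj L, Finset.Icc a b, fun j hj => ?_,
    ⟨e ≪≫ (DerivedCategory.quotientCompQhIso A).symm.app L⟩⟩
  have hL : IsZero (L.X j) := by
    rw [Finset.mem_Icc, not_and_or, not_le, not_le] at hj
    rcases hj with hj | hj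
    · exact L.isZero_of_isStrictlyGE a j hj
    · exact L.isZero_of_isStrictlyLE b j hj
  rw [Functor.isZero_iff]
  rintro ⟨Z⟩
  refine @AddCommGrpCat.isZero_of_subsingleton _ ⟨fun f g => ?_⟩
  exact (hoSingle_hom_eq_zero hL f).trans (hoSingle_hom_eq_zero hL g).symm

theorem exists_projectiveResolution_of_projDim_le {C : Type u} [Category.{v} C] [HasZeroObject C]
    [HasZeroMorphisms C] {F : C} {n : ℕ} (h : projDim F ≤ n) :
    ∃ P : ProjectiveResolution F, ∀ i, n < i → IsZero (P.complex.X i) := by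
  -- A strict bound on the infimum yields an actual resolution, of some length `d < n + 1`.
  have h' : projDim F < (n + 1 : ℕ) := h.trans_lt (by exact_mod_cast n.lt_succ_self)
  simp only [projDim, iInf_lt_iff] at h'
  obtain ⟨d, ⟨P, hP⟩, hd⟩ := h'
  have hd' : d < n + 1 := by exact_mod_cast hd
  exact ⟨P, fun i hi => hP i (by lia)⟩

end BoundedDerived

end RelDim

end

theorem theorem1p1 {A : Type u} [Category.{v} A] [Abelian A] [HasDerivedCategory.{w} A]
    (X : ObjectProperty A) [X.IsClosedUnderIsomorphisms] [X.ContainsZero]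
    [X.IsClosedUnderBinaryProducts]
    (hfin : RelDim.IsContravariantlyFinite X) (hgen : RelDim.Generates X) :
    RelDim.triangDim (RelDim.inDegreeZero.{w} X) ≤
      RelDim.gldim (RelDim.FPMod X.FullSubcategory) := by
  by_cases h : RelDim.gldim (RelDim.FPMod X.FullSubcategory) = ⊤
  · rw [h]
    exact le_top
  · obtain ⟨n, hn⟩ := ENat.ne_top_iff_exists.1 h
    rw [← hn]
    refine iInf₂_le n (eq_top_iff.2 fun B _ => ?_)
    obtain ⟨M, s, hs, ⟨e⟩⟩ := RelDim.exists_iso_Qh_of_bounded (X := X) B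
    refine RelDim.triangEnvelopeIter_of_hasRes hgen n M s (fun j _ => ?_) hs B e
    obtain ⟨P, hP⟩ := RelDim.exists_projectiveResolution_of_projDim_le
      (F := (⟨_, RelDim.isFinitelyPresented_hoHom hfin M j⟩ : RelDim.FPMod X.FullSubcategory))
      ((le_iSup _ _).trans hn.ge)
    exact RelDim.HasRes.of_projectiveResolution P hP
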